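/- Let $\mathbb K=\mathbb R$ or $\mathbb C$. For a Banach space $X$ over $\mathbb K$ let $\Pi(X)=\{(x^*,x)\in S_{X^*}\times S_X : x^*(x)=1\}$. The numerical radius of a bounded linear operator $T$ on $X$ is $v(T)=\sup\{|x^*(Tx)| : (x^*,x)\in\Pi(X)\}$, and the numerical index of $X$ is $n(X)=\inf\{v(T) : \|T\|=1\}$. Let $\mathcal L_v(X)$ be the space of all bounded linear operators on $X$ equipped with $v$ (if $n(X)>0$, then $v$ is a norm equivalent to the operator norm), and let $\mathcal K_v(X)$ be its subspace of compact operators. A closed subspace $J$ of a normed space $E$ is an M-ideal in $E$ if $E^*=J^*\oplus_1 J^\perp$, that is, if there is a linear projection $P$ of $E^*$ onto the annihilator $J^\perp$ of $J$ such that $\|f\|=\|Pf\|+\|f-Pf\|$ for all $f\in E^*$. Let $(F_i)_{i\in\mathbb N}$ be a sequence of finite-dimensional normed spaces over $\mathbb K$, and let $X$ be a nonzero space which is either the $\ell_p$-sum $\ell_p(F_i)$ for some $1<p<\infty$ or the $c_0$-sum $c_0(F_i)$. If $n(X)>0$, then $\mathcal K_v(X)$ is an M-ideal in $\mathcal L_v(X)$.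 In particular, let $1<p<\infty$, and let $\ell_p$ be the space of $p$-summable sequences of scalars in $\mathbb K$. Unless $\mathbb K=\mathbb R$ and $p=2$, we have $n(\ell_p)>0$, and $\mathcal K_v(\ell_p)$ is an M-ideal in $\mathcal L_v(\ell_p)$. -/

import Mathlib

open scoped ENNReal Topology

noncomputable section

section NumericalRadius

variable (𝕜 : Type*) [RCLike 𝕜] (X : Type*) [NormedAddCommGroup X] [NormedSpace 𝕜 X]

/-- The set `Π(X)` of all pairs `(x*, x)` in `S_{X*} × S_X` with `x*(x) = 1`. -/
def stateSet : Set (StrongDual 𝕜 X × X) :=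
  {q | ‖q.1‖ = 1 ∧ ‖q.2‖ = 1 ∧ q.1 q.2 = 1}

variable {𝕜 X}

/-- The numerical radius `v(T) = sup {|x*(T x)| : (x*, x) ∈ Π(X)}`. The set is bounded above by
`‖T‖` (see `bddAbove_numericalValues`). -/
def numericalRadius (T : X →L[𝕜] X) : ℝ :=
  sSup ((fun q : StrongDual 𝕜 X × X => ‖q.1 (T q.2)‖) '' stateSet 𝕜 X)

theorem bddAbove_numericalValues (T : X →L[𝕜] X) :
    BddAbove ((fun q : StrongDual 𝕜 X × X => ‖q.1 (T q.2)‖) '' stateSet 𝕜 X) := by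
  refine ⟨‖T‖, ?_⟩
  rintro _ ⟨⟨f, x⟩, ⟨hf, hx, -⟩, rfl⟩
  simp only at hf hx ⊢
  calc ‖f (T x)‖ ≤ ‖f‖ * ‖T x‖ := f.le_opNorm _
    _ ≤ 1 * (‖T‖ * 1) := by rw [hf]; gcongr; simpa [hx] using T.le_opNorm x
    _ = ‖T‖ := by ring

theorem numericalRadius_nonneg (T : X →L[𝕜] X) : 0 ≤ numericalRadius T := by
  apply Real.sSup_nonneg
  rintro _ ⟨q, -, rfl⟩
  exact norm_nonneg _

theorem numericalRadius_add_le (S T : X →L[𝕜] X) :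
    numericalRadius (S + T) ≤ numericalRadius S + numericalRadius T := by
  refine Real.sSup_le ?_ (add_nonneg (numericalRadius_nonneg S) (numericalRadius_nonneg T))
  rintro _ ⟨q, hq, rfl⟩
  have h : q.1 ((S + T) q.2) = q.1 (S q.2) + q.1 (T q.2) := by simp
  simp only [h]
  exact (norm_add_le _ _).trans (add_le_add
    (le_csSup (bddAbove_numericalValues S) ⟨q, hq, rfl⟩)
    (le_csSup (bddAbove_numericalValues T) ⟨q, hq, rfl⟩))

theorem numericalRadius_smul (c : 𝕜) (T : X →L[𝕜] X) :
    numericalRadius (c • T) = ‖c‖ * numericalRadius T := by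
  unfold numericalRadius
  rw [← smul_eq_mul, ← Real.sSup_smul_of_nonneg (norm_nonneg c)]
  congr 1
  ext r
  simp [Set.mem_smul_set]

variable (𝕜 X)

/-- The numerical index `n(X) = inf {v(T) : ‖T‖ = 1}`. -/
def numericalIndex : ℝ :=
  sInf (numericalRadius '' {T : X →L[𝕜] X | ‖T‖ = 1})

/-- The space `L_v(X)`: the bounded linear operators on `X`, with the numerical radius (and not the
operator norm) as norm. In general `v` is only a seminorm; it is a norm, equivalent to the operator
norm, as soon as `n(X) > 0`. -/
def NumRadOperators : Type _ := X →L[𝕜] X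

instance NumRadOperators.instAddCommGroup : AddCommGroup (NumRadOperators 𝕜 X) :=
  inferInstanceAs (AddCommGroup (X →L[𝕜] X))

instance NumRadOperators.instModule : Module 𝕜 (NumRadOperators 𝕜 X) :=
  inferInstanceAs (Module 𝕜 (X →L[𝕜] X))

/-- The identity map from `L_v(X)` to the bounded linear operators on `X`. -/
def NumRadOperators.toCLM : NumRadOperators 𝕜 X ≃ₗ[𝕜] (X →L[𝕜] X) :=
  LinearEquiv.refl 𝕜 (X →L[𝕜] X)

instance NumRadOperators.instNorm : Norm (NumRadOperators 𝕜 X) :=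
  ⟨fun T => numericalRadius (NumRadOperators.toCLM 𝕜 X T)⟩

theorem NumRadOperators.core : SeminormedSpace.Core 𝕜 (NumRadOperators 𝕜 X) where
  norm_nonneg T := numericalRadius_nonneg (toCLM 𝕜 X T)
  norm_smul c T := numericalRadius_smul c (toCLM 𝕜 X T)
  norm_triangle S T := numericalRadius_add_le (toCLM 𝕜 X S) (toCLM 𝕜 X T)

instance NumRadOperators.instSeminormedAddCommGroup :
    SeminormedAddCommGroup (NumRadOperators 𝕜 X) :=
  SeminormedAddCommGroup.ofCore (NumRadOperators.core 𝕜 X)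

instance NumRadOperators.instNormedSpace : NormedSpace 𝕜 (NumRadOperators 𝕜 X) where
  norm_smul_le c T := (numericalRadius_smul c (toCLM 𝕜 X T)).le

/-- The subspace `K_v(X)` of compact operators in `L_v(X)`. -/
def numRadCompacts : Submodule 𝕜 (NumRadOperators 𝕜 X) :=
  (compactOperator (RingHom.id 𝕜) X X).comap (NumRadOperators.toCLM 𝕜 X).toLinearMap

end NumericalRadius

section MIdeal

variable {𝕜 : Type*} [RCLike 𝕜] {E : Type*} [SeminormedAddCommGroup E] [NormedSpace 𝕜 E]

/-- The annihilator `J^⊥` of a subspace `J` in the topological dual. -/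
def topAnnihilator (J : Submodule 𝕜 E) : Submodule 𝕜 (StrongDual 𝕜 E) where
  carrier := {f | ∀ x ∈ J, f x = 0}
  add_mem' hf hg x hx := by simp [hf x hx, hg x hx]
  zero_mem' x _ := by simp
  smul_mem' c f hf x hx := by simp [hf x hx]

/-- `J` is an M-ideal in `E`: `J` is closed and `E* = J* ⊕₁ J^⊥`, that is, `J^⊥` is the range of an
L-projection `P` on `E*` (a projection with `‖f‖ = ‖P f‖ + ‖f - P f‖` for all `f`). The kernel of
`P` is then identified with `J*`, isometrically, by restriction of functionals to `J`. -/
def IsMIdeal (J : Submodule 𝕜 E) : Prop :=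
  IsClosed (J : Set E) ∧
    ∃ P : StrongDual 𝕜 E →L[𝕜] StrongDual 𝕜 E,
      (∀ f, P (P f) = P f) ∧ (∀ f, ‖f‖ = ‖P f‖ + ‖f - P f‖) ∧
        LinearMap.range P.toLinearMap = topAnnihilator J

end MIdeal

section Sums

variable (𝕜 : Type*) [RCLike 𝕜] (F : ℕ → Type*) [∀ i, NormedAddCommGroup (F i)]
  [∀ i, NormedSpace 𝕜 (F i)]

/-- The `c₀`-sum `c₀(F_i)`: all `x` with `x i ∈ F i` and `‖x i‖ → 0`, with the supremum norm, as a
subspace of the `ℓ_∞`-sum. -/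
def c0Sum : Submodule 𝕜 (lp F ∞) where
  carrier := {x | Filter.Tendsto (fun i => ‖x i‖) Filter.atTop (𝓝 0)}
  add_mem' {x y} hx hy := by
    refine squeeze_zero (fun i => norm_nonneg _) (fun i => ?_)
      (by simpa using Filter.Tendsto.add hx hy)
    simpa using norm_add_le (x i) (y i)
  zero_mem' := by simp
  smul_mem' c x hx := by
    have h := Filter.Tendsto.const_mul ‖c‖ hx
    simpa [norm_smul] using h

end Sums

end

/-!
Write `v` for the numerical radius.

The M-ideal property. Let `P n` be the projection of `X` onto its first `n` summands and
`Q n = 1 - P n`. If `x*(x) = 1 = ‖x*‖ = ‖x‖`, then Hölder's inequality for an `ℓ_p`- or `c₀`-sum is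
an equality, so the parts of `x*` and `x` under `P n` and `Q n` are again norm-attaining pairs, and
`v (P n S P n + Q n T Q n) ≤ max (v S) (v T)` (`IsAbsoluteApproximation.numericalRadius_block_le`).
Moreover `P n S P n → S` for compact `S`, as the projections tend to the identity pointwise on `X`
and on its dual (`IsAbsoluteApproximation.tendsto_conj_of_isCompactOperator`), and `T - Q n T Q n`
is compact. These three facts make the compact operators an M-ideal
(`isMIdeal_of_approximation`): a functional `g` that has the same norm as its restriction to the
compact operators satisfies `g (Q n T Q n) → 0`, since nothing of its norm is left over;
subtracting from `f` a Hahn–Banach extension `g` of its restriction to the compact operators, of the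
same norm as the restriction, leaves an annihilating functional, and testing on
`P n S P n + Q n T Q n` shows `‖g‖ + ‖f - g‖ = ‖f‖`. The functionals `g` which arise in this way are those with
`g (Q n T Q n) → 0` for all `T`; hence they form a subspace, and the decomposition is linear. The hypothesis
`n(X) > 0` serves to make the compact operators closed for `v`.

The numerical index of `ℓ_p`. Let `J z = |z|^{p-2} conj z`, acting coordinatewise. Then
`|⟨J z, T z⟩| ≤ v T * ‖z‖ ^ p`. For `a`, `b` of disjoint supports and `z = a + c b` this bounds
`c ⟨J a, T b⟩ + J c ⟨J b, T a⟩` by a multiple of `v T`. As soon as some scalar `β` has `J β ≠ β`,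
the choices `c = 1` and `c = β` bound both `⟨J a, T b⟩` and `⟨J b, T a⟩`. Such a scalar is `2` if
`p ≠ 2`, and `Complex.I` over the complex numbers. Splitting `x` according to the signs of the real
and imaginary parts of `J (x i) * (T x) i` then bounds `∑ |x i|^{p-1} |(T x) i|` by a multiple of
`v T` (`exists_absolute_numericalRadius_le`), and these sums control `‖T‖` (`norm_apply_rpow_le`).
-/

/-! ### A criterion for M-ideals -/

section MIdealCriterion

open Filter

variable {𝕜 : Type*} [RCLike 𝕜] {E : Type*} [SeminormedAddCommGroup E] [NormedSpace 𝕜 E]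

theorem exists_norm_le_one_lt_norm_apply (f : StrongDual 𝕜 E) {r : ℝ} (hr : r < ‖f‖) :
    ∃ x : E, ‖x‖ ≤ 1 ∧ r < ‖f x‖ := by
  rcases lt_or_ge r 0 with h0 | h0
  · exact ⟨0, by simp, by simpa using h0⟩
  by_contra! h
  refine hr.not_ge (f.opNorm_le_bound h0 fun x => ?_)
  rcases (norm_nonneg x).eq_or_lt with hx | hx
  · have := f.le_opNorm x
    rw [← hx, mul_zero] at this ⊢
    exact this
  · have hn : ‖((‖x‖⁻¹ : ℝ) : 𝕜)‖ = ‖x‖⁻¹ := by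
      rw [RCLike.norm_ofReal, abs_of_pos (inv_pos.2 hx)]
    have := h (((‖x‖⁻¹ : ℝ) : 𝕜) • x) (by rw [norm_smul, hn, inv_mul_cancel₀ hx.ne'])
    rw [map_smul, norm_smul, hn, inv_mul_le_iff₀ hx] at this
    linarith

/-- A functional `f` on `E` is normed by the subspace `J` if its restriction to `J` has the same
norm as `f`. -/
def IsNormedBy (J : Submodule 𝕜 E) (f : StrongDual 𝕜 E) : Prop :=
  ∀ r < ‖f‖, ∃ x ∈ J, ‖x‖ ≤ 1 ∧ r < ‖f x‖

/-- Replacing `f` by a Hahn–Banach extension of its restriction to `J` changes `f` by an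
annihilating functional. -/
theorem exists_isNormedBy_add_topAnnihilator (J : Submodule 𝕜 E) (f : StrongDual 𝕜 E) :
    ∃ g h : StrongDual 𝕜 E, IsNormedBy J g ∧ h ∈ topAnnihilator J ∧ f = g + h := by
  obtain ⟨g, hg, hgn⟩ := exists_extension_norm_eq J (f.comp J.subtypeL)
  refine ⟨g, f - g, fun r hr => ?_, fun x hx => ?_, by abel⟩
  · rw [hgn] at hr
    obtain ⟨x, hx1, hx2⟩ := exists_norm_le_one_lt_norm_apply _ hr
    exact ⟨x, x.2, hx1, by rw [hg]; exact hx2⟩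
  · have := hg ⟨x, hx⟩
    simp only [ContinuousLinearMap.coe_comp, Function.comp_apply, Submodule.subtypeL_apply] at this
    simp [this]

/-- If a functional is bounded by `C` on every unimodular combination of `a` and `b`, then the
moduli of its values add up to at most `C`. -/
theorem norm_apply_add_norm_apply_le (f : StrongDual 𝕜 E) {a b : E} {C : ℝ}
    (h : ∀ c : 𝕜, ‖c‖ = 1 → ‖a + c • b‖ ≤ C) : ‖f a‖ + ‖f b‖ ≤ ‖f‖ * C := by
  obtain ⟨c, hc, hca⟩ := RCLike.exists_norm_eq_mul_self (f a)
  obtain ⟨d, hd, hdb⟩ := RCLike.exists_norm_eq_mul_self (f b)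
  have hc0 : c ≠ 0 := fun h0 => by simp [h0] at hc
  have key : c * f (a + (c⁻¹ * d) • b) = ((‖f a‖ + ‖f b‖ : ℝ) : 𝕜) := by
    rw [map_add, map_smul, smul_eq_mul, mul_add, ← mul_assoc, mul_inv_cancel_left₀ hc0, ← hca,
      ← hdb]
    push_cast; rfl
  have h2 : ‖f (a + (c⁻¹ * d) • b)‖ = ‖f a‖ + ‖f b‖ := by
    have := congrArg norm key
    rwa [norm_mul, hc, one_mul, RCLike.norm_ofReal, abs_of_nonneg (by positivity)] at this
  rw [← h2]
  exact (f.le_opNorm _).trans (mul_le_mul_of_nonneg_left (h _ (by simp [hc, hd])) (norm_nonneg _))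

section

variable {J : Submodule 𝕜 E} {A B : ℕ → E →ₗ[𝕜] E}

/-- A functional normed by `J` spends its whole norm near some `A n S`, so that nothing is left
for the vectors `B n T`. -/
theorem IsNormedBy.tendsto_zero {f : StrongDual 𝕜 E} (hf : IsNormedBy J f)
    (hA : ∀ S ∈ J, Tendsto (fun n => A n S) atTop (𝓝 S))
    (hAB : ∀ n, ∀ S ∈ J, ∀ T, ‖A n S + B n T‖ ≤ max ‖S‖ ‖T‖) (T : E) :
    Tendsto (fun n => f (B n T)) atTop (𝓝 0) := by
  have unit : ∀ T : E, ‖T‖ ≤ 1 → Tendsto (fun n => f (B n T)) atTop (𝓝 0) := by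
    intro T hT
    rw [tendsto_zero_iff_norm_tendsto_zero, Metric.tendsto_nhds]
    intro ε hε
    obtain ⟨S, hS, hS1, hfS⟩ := hf (‖f‖ - ε) (by linarith)
    have hlim : Tendsto (fun n => ‖f (A n S)‖) atTop (𝓝 ‖f S‖) :=
      ((f.continuous.tendsto S).comp (hA S hS)).norm
    filter_upwards [hlim.eventually (lt_mem_nhds hfS)] with n hn
    have := norm_apply_add_norm_apply_le f (a := A n S) (b := B n T) (C := 1) fun c hc => by
      rw [← map_smul]
      exact (hAB n S hS (c • T)).trans (max_le hS1 (by rwa [norm_smul, hc, one_mul]))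
    rw [dist_zero_right, norm_norm]
    linarith
  have hpos : 0 < ‖T‖ + 1 := by positivity
  have hne : ((‖T‖ + 1 : ℝ) : 𝕜) ≠ 0 := by exact_mod_cast hpos.ne'
  have h := (unit (((‖T‖ + 1 : ℝ) : 𝕜)⁻¹ • T) (by
    rw [norm_smul, norm_inv, RCLike.norm_ofReal, abs_of_pos hpos, inv_mul_le_iff₀ hpos]
    linarith)).const_mul ((‖T‖ + 1 : ℝ) : 𝕜)
  simpa only [map_smul, smul_eq_mul, mul_inv_cancel_left₀ hne, mul_zero] using h

/-- Testing `g + h` on `A n S + B n T`, where `S` nearly norms `g` and `T` nearly norms `h`, shows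
that the norms add. -/
theorem IsNormedBy.norm_add_norm_le {g h : StrongDual 𝕜 E} (hg : IsNormedBy J g)
    (hh : h ∈ topAnnihilator J)
    (hA : ∀ S ∈ J, Tendsto (fun n => A n S) atTop (𝓝 S))
    (hB : ∀ n T, T - B n T ∈ J)
    (hAB : ∀ n, ∀ S ∈ J, ∀ T, ‖A n S + B n T‖ ≤ max ‖S‖ ‖T‖) :
    ‖g‖ + ‖h‖ ≤ ‖g + h‖ := by
  refine le_of_forall_pos_lt_add fun ε hε => ?_
  obtain ⟨S, hS, hS1, hgS⟩ := hg (‖g‖ - ε / 2) (by linarith)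
  obtain ⟨T, hT1, hhT⟩ := exists_norm_le_one_lt_norm_apply h (r := ‖h‖ - ε / 2) (by linarith)
  have h1 : Tendsto (fun n => ‖(g + h) (A n S)‖) atTop (𝓝 ‖g S‖) := by
    have := (((g + h).continuous.tendsto S).comp (hA S hS)).norm
    simpa [hh S hS] using this
  have h2 : Tendsto (fun n => ‖(g + h) (B n T)‖) atTop (𝓝 ‖h T‖) := by
    have hBT : ∀ n, h (B n T) = h T := fun n => by
      have := hh _ (hB n T)
      rw [map_sub, sub_eq_zero] at this
      exact this.symm
    have := ((hg.tendsto_zero hA hAB T).add (tendsto_const_nhds (x := h T))).norm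
    simpa [hBT] using this
  have h3 : ‖g S‖ + ‖h T‖ ≤ ‖g + h‖ * 1 := le_of_tendsto (h1.add h2) <| Eventually.of_forall fun n =>
    norm_apply_add_norm_apply_le (g + h) fun c hc => by
      rw [← map_smul]
      exact (hAB n S hS (c • T)).trans (max_le hS1 (by rwa [norm_smul, hc, one_mul]))
  linarith

/-- A closed subspace `J` is an M-ideal if there are linear maps `A n`, tending to the identity
pointwise on `J`, and `B n`, congruent to the identity modulo `J`, such that
`‖A n S + B n T‖ ≤ max ‖S‖ ‖T‖`. -/
theorem isMIdeal_of_approximation (hJ : IsClosed (J : Set E))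
    (hA : ∀ S ∈ J, Tendsto (fun n => A n S) atTop (𝓝 S))
    (hB : ∀ n T, T - B n T ∈ J)
    (hAB : ∀ n, ∀ S ∈ J, ∀ T, ‖A n S + B n T‖ ≤ max ‖S‖ ‖T‖) : IsMIdeal J := by
  -- the functionals normed by `J` form this subspace, which makes the decomposition linear
  let N : Submodule 𝕜 (StrongDual 𝕜 E) :=
    { carrier := {f | ∀ T, Tendsto (fun n => f (B n T)) atTop (𝓝 0)}
      add_mem' := fun {f g} hf hg T => by simpa using (hf T).add (hg T)
      zero_mem' := fun T => by simp
      smul_mem' := fun c f hf T => by simpa using (hf T).const_mul c }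
  have hdisj : ∀ f ∈ N, f ∈ topAnnihilator J → f = 0 := by
    intro f hf hf'
    ext T
    refine tendsto_nhds_unique (tendsto_const_nhds.congr fun n => ?_) (hf T)
    have := hf' _ (hB n T)
    rwa [map_sub, sub_eq_zero] at this
  have hN : ∀ f ∈ N, IsNormedBy J f := by
    intro f hf
    obtain ⟨g, h, hg, hh, rfl⟩ := exists_isNormedBy_add_topAnnihilator J f
    have hgN : g ∈ N := hg.tendsto_zero hA hAB
    have : h ∈ N := by simpa using N.sub_mem hf hgN
    rwa [hdisj h this hh, add_zero]
  have hc : IsCompl (topAnnihilator J) N := by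
    refine IsCompl.of_eq ?_ ?_
    · rw [Submodule.eq_bot_iff]
      exact fun f hf => hdisj f hf.2 hf.1
    · rw [Submodule.eq_top_iff']
      intro f
      obtain ⟨g, h, hg, hh, rfl⟩ := exists_isNormedBy_add_topAnnihilator J f
      exact add_mem (Submodule.mem_sup_right (hg.tendsto_zero hA hAB)) (Submodule.mem_sup_left hh)
  let P := (topAnnihilator J).projection N hc
  have hnorm : ∀ f, ‖f‖ = ‖P f‖ + ‖f - P f‖ := by
    intro f
    have h1 := (hN _ (Submodule.sub_projection_mem hc f)).norm_add_norm_le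
      (Submodule.projection_apply_mem hc f) hA hB hAB
    have h2 := norm_add_le (P f) (f - P f)
    rw [sub_add_cancel] at h1
    rw [add_sub_cancel] at h2
    change ‖f - P f‖ + ‖P f‖ ≤ ‖f‖ at h1
    linarith
  refine ⟨hJ, P.mkContinuous 1 fun f => ?_, fun f => ?_, hnorm, ?_⟩
  · have := hnorm f
    have := norm_nonneg (f - P f)
    linarith
  · exact Submodule.projection_apply_of_mem_left hc (Submodule.projection_apply_mem hc f)
  · exact Submodule.range_projection hc

end

end MIdealCriterion

/-! ### Numerical radius and approximating projections -/

section Approximation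

open Filter

variable {𝕜 : Type*} [RCLike 𝕜] {X : Type*} [NormedAddCommGroup X] [NormedSpace 𝕜 X]

theorem numericalRadius_le {T : X →L[𝕜] X} {C : ℝ} (hC : 0 ≤ C)
    (h : ∀ (φ : StrongDual 𝕜 X) (x : X), ‖φ‖ = 1 → ‖x‖ = 1 → φ x = 1 → ‖φ (T x)‖ ≤ C) :
    numericalRadius T ≤ C :=
  Real.sSup_le (by rintro _ ⟨q, hq, rfl⟩; exact h _ _ hq.1 hq.2.1 hq.2.2) hC

theorem numericalRadius_le_norm (T : X →L[𝕜] X) : numericalRadius T ≤ ‖T‖ :=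
  numericalRadius_le (norm_nonneg T) fun φ x hφ hx _ => by
    simpa [hφ, hx] using (φ.le_opNorm (T x)).trans
      (mul_le_mul_of_nonneg_left (T.le_opNorm x) (norm_nonneg φ))

/-- The homogeneous form of the definition of the numerical radius. -/
theorem norm_apply_le_numericalRadius (T : X →L[𝕜] X) {φ : StrongDual 𝕜 X} {x : X}
    (h : φ x = ((‖φ‖ * ‖x‖ : ℝ) : 𝕜)) : ‖φ (T x)‖ ≤ numericalRadius T * (‖φ‖ * ‖x‖) := by
  rcases (norm_nonneg φ).eq_or_lt with hφ | hφ
  · simp [norm_eq_zero.1 hφ.symm]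
  rcases (norm_nonneg x).eq_or_lt with hx | hx
  · simp [norm_eq_zero.1 hx.symm]
  have hφ' : ((‖φ‖ : ℝ) : 𝕜) ≠ 0 := by exact_mod_cast hφ.ne'
  have hx' : ((‖x‖ : ℝ) : 𝕜) ≠ 0 := by exact_mod_cast hx.ne'
  have := le_csSup (bddAbove_numericalValues T)
    ⟨(((‖φ‖ : ℝ) : 𝕜)⁻¹ • φ, ((‖x‖ : ℝ) : 𝕜)⁻¹ • x), ⟨?_, ?_, ?_⟩, rfl⟩
  · simp only [map_smul, FunLike.coe_smul, Pi.smul_apply, smul_eq_mul, norm_mul,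
      norm_inv, RCLike.norm_ofReal, abs_norm] at this
    rw [← mul_assoc, ← mul_inv, inv_mul_le_iff₀ (by positivity)] at this
    unfold numericalRadius
    linarith
  · simp [norm_smul, hφ.ne']
  · simp [norm_smul, hx.ne']
  · simp only [map_smul, FunLike.coe_smul, Pi.smul_apply, smul_eq_mul, h]
    push_cast
    field_simp

theorem numericalIndex_mul_norm_le (T : X →L[𝕜] X) :
    numericalIndex 𝕜 X * ‖T‖ ≤ numericalRadius T := by
  rcases (norm_nonneg T).eq_or_lt with hT | hT
  · rw [← hT, mul_zero]; exact numericalRadius_nonneg T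
  have h : numericalIndex 𝕜 X ≤ numericalRadius (((‖T‖⁻¹ : ℝ) : 𝕜) • T) :=
    csInf_le ⟨0, by rintro _ ⟨S, -, rfl⟩; exact numericalRadius_nonneg S⟩
      ⟨_, by simp [norm_smul, hT.ne'], rfl⟩
  rw [numericalRadius_smul, RCLike.norm_ofReal, abs_of_pos (inv_pos.2 hT)] at h
  calc _ ≤ (‖T‖⁻¹ * numericalRadius T) * ‖T‖ := by gcongr
    _ = numericalRadius T := by field_simp

/-- When `n(X) > 0`, the numerical radius dominates the operator norm, for which the compact
operators are closed. -/
theorem isClosed_numRadCompacts [CompleteSpace X] (h : 0 < numericalIndex 𝕜 X) :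
    IsClosed (numRadCompacts 𝕜 X : Set (NumRadOperators 𝕜 X)) := by
  have hcont : Continuous (NumRadOperators.toCLM 𝕜 X) :=
    AddMonoidHomClass.continuous_of_bound (NumRadOperators.toCLM 𝕜 X) (numericalIndex 𝕜 X)⁻¹
      fun T => by
        rw [← div_eq_inv_mul, le_div_iff₀' h]
        exact numericalIndex_mul_norm_le (NumRadOperators.toCLM 𝕜 X T)
  exact isClosed_setOfPred_isCompactOperator.preimage hcont

/-- A sequence of finite-rank projections `P n` tending to the identity pointwise, for which the
norm of `X` behaves like the norm of an absolute sum of the range and the kernel of `P n`: the norm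
of `x` is monotone in `‖P n x‖` and `‖x - P n x‖`, and a perturbation of size `t` within the kernel
of a vector in the unit ball of the range increases the norm by at most `o(t)`, uniformly in `n`. -/
structure IsAbsoluteApproximation (P : ℕ → X →L[𝕜] X) : Prop where
  idem : ∀ n x, P n (P n x) = P n x
  finite_range : ∀ n, FiniteDimensional 𝕜 (P n).range
  tendsto : ∀ x, Tendsto (fun n => P n x) atTop (𝓝 x)
  mono : ∀ n x y, ‖P n y‖ ≤ ‖P n x‖ → ‖y - P n y‖ ≤ ‖x - P n x‖ → ‖y‖ ≤ ‖x‖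
  smooth : ∃ r : ℝ, 1 < r ∧ ∀ n x y, ∀ t : ℝ, 0 < t → t ≤ 1 → ‖x‖ ≤ 1 → ‖y‖ ≤ 1 →
    ‖P n x + (t : 𝕜) • (y - P n y)‖ ≤ 1 + t ^ r

namespace IsAbsoluteApproximation

variable {P : ℕ → X →L[𝕜] X} (hP : IsAbsoluteApproximation P)
include hP

theorem norm_apply_le (n : ℕ) (x : X) : ‖P n x‖ ≤ ‖x‖ :=
  hP.mono n x (P n x) (by rw [hP.idem]) (by simp [hP.idem])

theorem norm_sub_apply_le (n : ℕ) (x : X) : ‖x - P n x‖ ≤ ‖x‖ :=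
  hP.mono n x (x - P n x) (by simp [hP.idem]) (by simp [hP.idem])

theorem norm_le_one (n : ℕ) : ‖P n‖ ≤ 1 :=
  (P n).opNorm_le_bound zero_le_one fun x => by simpa using hP.norm_apply_le n x

theorem norm_id_sub_le_one (n : ℕ) : ‖ContinuousLinearMap.id 𝕜 X - P n‖ ≤ 1 :=
  ContinuousLinearMap.opNorm_le_bound _ zero_le_one fun x => by
    simpa using hP.norm_sub_apply_le n x

/-- The projections tend to the identity pointwise on the dual as well. -/
theorem tendsto_comp_dual (φ : StrongDual 𝕜 X) :
    Tendsto (fun n => φ.comp (ContinuousLinearMap.id 𝕜 X - P n)) atTop (𝓝 0) := by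
  rw [tendsto_zero_iff_norm_tendsto_zero, Metric.tendsto_nhds]
  intro δ hδ
  obtain ⟨r, hr, hsm⟩ := hP.smooth
  -- choose `t` so small that the gain `t * δ` beats the loss `‖φ‖ * t ^ r`
  obtain ⟨t, ht0, ht1, ht⟩ : ∃ t : ℝ, 0 < t ∧ t ≤ 1 ∧ ‖φ‖ * t ^ (r - 1) < δ := by
    have h1 : Tendsto (fun t : ℝ => ‖φ‖ * t ^ (r - 1)) (𝓝[>] 0) (𝓝 0) := by
      have := ((Real.continuousAt_rpow_const 0 (r - 1) (Or.inr (by linarith))).tendsto.const_mul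
        ‖φ‖).mono_left (nhdsWithin_le_nhds (s := Set.Ioi 0))
      simpa [Real.zero_rpow (by linarith : r - 1 ≠ 0)] using this
    obtain ⟨t, ht, ht'⟩ := ((h1.eventually (gt_mem_nhds hδ)).and
      (Ioc_mem_nhdsGT (zero_lt_one' ℝ))).exists
    exact ⟨t, ht'.1, ht'.2, ht⟩
  have htr : ‖φ‖ * t ^ r < t * δ := by
    have : t ^ r = t * t ^ (r - 1) := by
      rw [Real.rpow_sub ht0, Real.rpow_one]; field_simp
    rw [this]; nlinarith
  obtain ⟨x, hx1, hx⟩ := exists_norm_le_one_lt_norm_apply φ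
    (r := ‖φ‖ - (t * δ - ‖φ‖ * t ^ r)) (by linarith)
  have hlim : Tendsto (fun n => ‖φ (P n x)‖) atTop (𝓝 ‖φ x‖) :=
    ((φ.continuous.tendsto x).comp (hP.tendsto x)).norm
  filter_upwards [hlim.eventually (lt_mem_nhds hx)] with n hn
  rw [dist_zero_right, norm_norm]
  by_contra! hcon
  have key : ∀ s < δ, ‖φ (P n x)‖ + t * s ≤ ‖φ‖ * (1 + t ^ r) := by
    intro s hs
    obtain ⟨y, hy1, hy⟩ := exists_norm_le_one_lt_norm_apply _ (hs.trans_le hcon)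
    have := norm_apply_add_norm_apply_le φ (a := P n x) (b := (t : 𝕜) • (y - P n y))
      (C := 1 + t ^ r) fun c hc => by
        have := hsm n x (c • y) t ht0 ht1 hx1 (by rwa [norm_smul, hc, one_mul])
        rwa [map_smul, ← smul_sub, smul_comm] at this
    rw [map_smul, norm_smul, RCLike.norm_ofReal, abs_of_pos ht0] at this
    have h2 : ‖(φ.comp (ContinuousLinearMap.id 𝕜 X - P n)) y‖ = ‖φ (y - P n y)‖ := by simp
    rw [h2] at hy
    nlinarith
  have h4 : t * δ ≤ ‖φ‖ * (1 + t ^ r) - ‖φ (P n x)‖ := by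
    rw [mul_comm, ← le_div_iff₀ ht0]
    refine le_of_forall_lt fun s hs => ?_
    obtain ⟨s', hs1, hs2⟩ := exists_between hs
    have := key s' hs2
    refine hs1.trans_le ?_
    rw [le_div_iff₀ ht0]
    linarith
  linarith

theorem tendsto_id_sub_comp_of_isCompactOperator {S : X →L[𝕜] X} (hS : IsCompactOperator S) :
    Tendsto (fun n => (ContinuousLinearMap.id 𝕜 X - P n).comp S) atTop (𝓝 0) := by
  rw [tendsto_zero_iff_norm_tendsto_zero, Metric.tendsto_nhds]
  intro ε hε
  obtain ⟨K, hK, hSK⟩ := IsCompactOperator.image_closedBall_subset_compact (f := S.toLinearMap) hS 1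
  obtain ⟨t, ht, hKt⟩ := Metric.totallyBounded_iff.1 hK.totallyBounded (ε / 3) (by linarith)
  -- on a finite net of `K` the convergence is uniform, and `1 - P n` is a contraction
  have hev : ∀ᶠ n in atTop, ∀ y ∈ t, dist (P n y) y < ε / 3 :=
    (eventually_all_finite ht).2 fun y _ => (Metric.tendsto_nhds.1 (hP.tendsto y)) _ (by linarith)
  filter_upwards [hev] with n hn
  rw [dist_zero_right, norm_norm]
  refine lt_of_le_of_lt (b := 2 * ε / 3)
    (ContinuousLinearMap.opNorm_le_of_unit_norm (by positivity) ?_) (by linarith)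
  · intro x hx
    obtain ⟨y, hy, hxy⟩ := Set.mem_iUnion₂.1
      (hKt (hSK ⟨x, by simp [hx], rfl⟩))
    have h1 := hP.norm_sub_apply_le n (S x - y)
    have h2 := hn y hy
    rw [dist_comm, dist_eq_norm] at h2
    rw [Metric.mem_ball, dist_eq_norm] at hxy
    change ‖S x - y‖ < _ at hxy
    have h3 : (ContinuousLinearMap.id 𝕜 X - P n).comp S x =
        ((S x - y) - P n (S x - y)) + (y - P n y) := by
      simp only [ContinuousLinearMap.coe_comp, Function.comp_apply, FunLike.coe_sub, Pi.sub_apply,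
        ContinuousLinearMap.id_apply, map_sub]
      abel
    rw [h3]
    refine (norm_add_le _ _).trans ?_
    linarith

theorem tendsto_comp_id_sub_of_finite_range {S : X →L[𝕜] X} [FiniteDimensional 𝕜 S.range] :
    Tendsto (fun n => S.comp (ContinuousLinearMap.id 𝕜 X - P n)) atTop (𝓝 0) := by
  let b := Module.finBasis 𝕜 S.range
  let φ : Fin _ → StrongDual 𝕜 X := fun i =>
    (LinearMap.toContinuousLinearMap (b.coord i)).comp
      (S.codRestrict S.range fun x => LinearMap.mem_range_self _ x)
  have hS : ∀ n, S.comp (ContinuousLinearMap.id 𝕜 X - P n) =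
      ∑ i, ((φ i).comp (ContinuousLinearMap.id 𝕜 X - P n)).smulRight (b i : X) := by
    intro n
    ext x
    have := b.sum_repr ⟨S (x - P n x), LinearMap.mem_range_self _ _⟩
    have h2 := congrArg Subtype.val this
    simp only [Submodule.coe_sum, Submodule.coe_smul] at h2
    simp only [ContinuousLinearMap.coe_comp, Function.comp_apply, FunLike.coe_sub, Pi.sub_apply,
      ContinuousLinearMap.id_apply, sum_apply, ContinuousLinearMap.smulRight_apply]
    rw [← h2]
    rfl
  simp_rw [hS]
  rw [← Finset.sum_const_zero (s := Finset.univ) (M := X →L[𝕜] X) (ι := Fin _)]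
  refine tendsto_finsetSum _ fun i _ => ?_
  rw [tendsto_zero_iff_norm_tendsto_zero]
  have := (tendsto_zero_iff_norm_tendsto_zero.1 (hP.tendsto_comp_dual (φ i))).mul_const ‖(b i : X)‖
  simpa [ContinuousLinearMap.norm_smulRight_apply] using this

theorem isCompactOperator (n : ℕ) : IsCompactOperator (P n) := by
  have := hP.finite_range n
  have : ProperSpace (P n).range := FiniteDimensional.proper_rclike 𝕜 _
  exact (isCompactOperator_of_locallyCompactSpace_dom
    ((P n).codRestrict (P n).range fun x => LinearMap.mem_range_self _ x)).clm_comp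
      (P n).range.subtypeL

theorem tendsto_comp_id_sub_of_isCompactOperator {S : X →L[𝕜] X} (hS : IsCompactOperator S) :
    Tendsto (fun n => S.comp (ContinuousLinearMap.id 𝕜 X - P n)) atTop (𝓝 0) := by
  rw [tendsto_zero_iff_norm_tendsto_zero, Metric.tendsto_nhds]
  intro ε hε
  have h1 := tendsto_zero_iff_norm_tendsto_zero.1 (hP.tendsto_id_sub_comp_of_isCompactOperator hS)
  -- replace `S` by the finite-rank operator `P m S`
  obtain ⟨m, hm⟩ := (h1.eventually (gt_mem_nhds (half_pos hε))).exists
  have := hP.finite_range m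
  have : FiniteDimensional 𝕜 ((P m).comp S).range :=
    Submodule.finiteDimensional_of_le (S₂ := (P m).range) (by
      rintro _ ⟨x, rfl⟩; exact ⟨S x, rfl⟩)
  have h2 := tendsto_zero_iff_norm_tendsto_zero.1
    (hP.tendsto_comp_id_sub_of_finite_range (S := (P m).comp S))
  filter_upwards [h2.eventually (gt_mem_nhds (half_pos hε))] with n hn
  rw [dist_zero_right, norm_norm]
  have hdec : S.comp (ContinuousLinearMap.id 𝕜 X - P n) =
      ((ContinuousLinearMap.id 𝕜 X - P m).comp S).comp (ContinuousLinearMap.id 𝕜 X - P n) +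
        ((P m).comp S).comp (ContinuousLinearMap.id 𝕜 X - P n) := by
    ext x; simp; abel
  have h3 : ‖((ContinuousLinearMap.id 𝕜 X - P m).comp S).comp (ContinuousLinearMap.id 𝕜 X - P n)‖
      ≤ ‖(ContinuousLinearMap.id 𝕜 X - P m).comp S‖ :=
    (ContinuousLinearMap.opNorm_comp_le _ _).trans
      (mul_le_of_le_one_right (norm_nonneg _) (hP.norm_id_sub_le_one n))
  rw [hdec]
  refine (norm_add_le _ _).trans_lt ?_
  linarith

theorem tendsto_conj_of_isCompactOperator {S : X →L[𝕜] X} (hS : IsCompactOperator S) :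
    Tendsto (fun n => (P n).comp (S.comp (P n))) atTop (𝓝 S) := by
  rw [tendsto_iff_norm_sub_tendsto_zero]
  have h1 := tendsto_zero_iff_norm_tendsto_zero.1 (hP.tendsto_id_sub_comp_of_isCompactOperator hS)
  have h2 := tendsto_zero_iff_norm_tendsto_zero.1 (hP.tendsto_comp_id_sub_of_isCompactOperator hS)
  refine squeeze_zero (fun n => norm_nonneg _) (fun n => ?_)
    (by simpa only [add_zero] using h1.add h2)
  have hdec : (P n).comp (S.comp (P n)) - S = -((ContinuousLinearMap.id 𝕜 X - P n).comp S) -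
      (P n).comp (S.comp (ContinuousLinearMap.id 𝕜 X - P n)) := by
    ext x; simp
  rw [hdec]
  refine (norm_sub_le _ _).trans ?_
  rw [norm_neg]
  refine add_le_add le_rfl ?_
  exact (ContinuousLinearMap.opNorm_comp_le _ _).trans
      (mul_le_of_le_one_left (norm_nonneg _) (hP.norm_le_one n))

/-- The duality inequality of absolute sums: the two parts of a functional and the two parts of a
vector pair no better than the functional and the vector themselves. -/
theorem norm_mul_norm_add_le (n : ℕ) (φ : StrongDual 𝕜 X) (x : X) :
    ‖φ.comp (P n)‖ * ‖P n x‖ + ‖φ.comp (ContinuousLinearMap.id 𝕜 X - P n)‖ * ‖x - P n x‖ ≤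
      ‖φ‖ * ‖x‖ := by
  have key : ∀ s < ‖φ.comp (P n)‖, ∀ t < ‖φ.comp (ContinuousLinearMap.id 𝕜 X - P n)‖,
      s * ‖P n x‖ + t * ‖x - P n x‖ ≤ ‖φ‖ * ‖x‖ := by
    intro s hs t ht
    obtain ⟨u, hu, hsu⟩ := exists_norm_le_one_lt_norm_apply _ hs
    obtain ⟨w, hw, htw⟩ := exists_norm_le_one_lt_norm_apply _ ht
    have := norm_apply_add_norm_apply_le φ (a := ((‖P n x‖ : ℝ) : 𝕜) • P n u)
      (b := ((‖x - P n x‖ : ℝ) : 𝕜) • (w - P n w)) (C := ‖x‖) fun c hc => by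
        refine hP.mono n _ _ ?_ ?_
        · simp only [map_add, map_smul, map_sub, hP.idem, sub_self, smul_zero, add_zero, norm_smul,
            RCLike.norm_ofReal, abs_norm]
          exact mul_le_of_le_one_right (norm_nonneg _) ((hP.norm_apply_le n u).trans hu)
        · simp only [map_add, map_smul, map_sub, hP.idem, sub_self, smul_zero, add_zero,
            add_sub_cancel_left, norm_smul, hc, one_mul, RCLike.norm_ofReal, abs_norm]
          exact mul_le_of_le_one_right (norm_nonneg _) ((hP.norm_sub_apply_le n w).trans hw)
    simp only [map_smul, norm_smul, RCLike.norm_ofReal, abs_norm] at this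
    have e1 : s ≤ ‖φ (P n u)‖ := hsu.le
    have e2 : t ≤ ‖φ (w - P n w)‖ := by simpa using htw.le
    nlinarith [norm_nonneg (P n x), norm_nonneg (x - P n x),
      mul_le_mul_of_nonneg_right e1 (norm_nonneg (P n x)),
      mul_le_mul_of_nonneg_right e2 (norm_nonneg (x - P n x))]
  -- let `s` and `t` tend to the norms
  refine le_of_forall_pos_le_add fun ε hε => ?_
  set a := ‖P n x‖
  set b := ‖x - P n x‖
  have hpos : 0 < a + b + 1 := by positivity
  have h := key (‖φ.comp (P n)‖ - ε / (a + b + 1)) (by linarith [div_pos hε hpos])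
    (‖φ.comp (ContinuousLinearMap.id 𝕜 X - P n)‖ - ε / (a + b + 1)) (by linarith [div_pos hε hpos])
  have h2 : ε / (a + b + 1) * (a + b) ≤ ε := by
    rw [div_mul_eq_mul_div, div_le_iff₀ hpos]; nlinarith
  nlinarith

/-- If `(φ, x)` is a state, the parts of `φ` and of `x` are again states up to scaling, so the two
diagonal blocks contribute a weighted mean of numerical values of `S` and `T`. -/
theorem numericalRadius_block_le (n : ℕ) (S T : X →L[𝕜] X) :
    numericalRadius ((P n).comp (S.comp (P n)) +
      (ContinuousLinearMap.id 𝕜 X - P n).comp (T.comp (ContinuousLinearMap.id 𝕜 X - P n))) ≤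
      max (numericalRadius S) (numericalRadius T) := by
  refine numericalRadius_le ((numericalRadius_nonneg S).trans (le_max_left _ _)) ?_
  intro φ x hφ hx hφx
  set Q := ContinuousLinearMap.id 𝕜 X - P n with hQ
  have hQx : Q x = x - P n x := by simp [hQ]
  have hab := hP.norm_mul_norm_add_le n φ x
  rw [hφ, hx, mul_one, ← hQ, ← hQx] at hab
  set a := ‖φ.comp (P n)‖ * ‖P n x‖ with ha
  set b := ‖φ.comp Q‖ * ‖Q x‖ with hb
  have hPP : φ (P n x) = φ.comp (P n) (P n x) := by simp [hP.idem]
  have hQQ : φ (Q x) = φ.comp Q (Q x) := by simp [hQ, hP.idem]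
  have hna : ‖φ (P n x)‖ ≤ a := by rw [hPP]; exact ContinuousLinearMap.le_opNorm _ _
  have hnb : ‖φ (Q x)‖ ≤ b := by rw [hQQ]; exact ContinuousLinearMap.le_opNorm _ _
  have hsum : φ (P n x) + φ (Q x) = 1 := by rw [← map_add, hQx, add_sub_cancel, hφx]
  have hre : RCLike.re (φ (P n x)) + RCLike.re (φ (Q x)) = 1 := by
    rw [← map_add, hsum, RCLike.one_re]
  have eq_of : ∀ (z : 𝕜) (c : ℝ), ‖z‖ ≤ c → c ≤ RCLike.re z → z = (c : 𝕜) := by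
    intro z c h1 h2
    rw [← RCLike.re_eq_self_of_le (h1.trans h2),
      le_antisymm ((RCLike.re_le_norm z).trans h1) h2]
  have h1 : φ.comp (P n) (P n x) = ((a : ℝ) : 𝕜) := by
    rw [← hPP]
    -- the real parts add up to `1`, their bounds `a` and `b` to at most `1`: both are attained
    exact eq_of _ _ hna (by linarith [(RCLike.re_le_norm (φ (Q x))).trans hnb])
  have h2 : φ.comp Q (Q x) = ((b : ℝ) : 𝕜) := by
    rw [← hQQ]
    exact eq_of _ _ hnb (by linarith [(RCLike.re_le_norm (φ (P n x))).trans hna])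
  have h3 := norm_apply_le_numericalRadius S h1
  have h4 := norm_apply_le_numericalRadius T h2
  rw [← ha] at h3
  rw [← hb] at h4
  have ha0 : 0 ≤ a := by positivity
  have hb0 : 0 ≤ b := by positivity
  calc ‖φ (((P n).comp (S.comp (P n)) + Q.comp (T.comp Q)) x)‖
      = ‖φ.comp (P n) (S (P n x)) + φ.comp Q (T (Q x))‖ := by simp
    _ ≤ numericalRadius S * a + numericalRadius T * b := (norm_add_le _ _).trans (add_le_add h3 h4)
    _ ≤ max (numericalRadius S) (numericalRadius T) * a +
        max (numericalRadius S) (numericalRadius T) * b := by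
      gcongr
      · exact le_max_left _ _
      · exact le_max_right _ _
    _ ≤ max (numericalRadius S) (numericalRadius T) := by
      rw [← mul_add]
      exact mul_le_of_le_one_right ((numericalRadius_nonneg S).trans (le_max_left _ _)) hab

/-- The diagonal blocks `P n S P n` and `(1 - P n) T (1 - P n)` meet the criterion for M-ideals. -/
theorem isMIdeal_numRadCompacts [CompleteSpace X] (h : 0 < numericalIndex 𝕜 X) :
    IsMIdeal (numRadCompacts 𝕜 X) := by
  let ι := NumRadOperators.toCLM 𝕜 X
  -- compressions to the diagonal blocks of `P n`
  let conj (R : X →L[𝕜] X) : NumRadOperators 𝕜 X →ₗ[𝕜] NumRadOperators 𝕜 X :=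
    { toFun := fun T => ι.symm (R.comp ((ι T).comp R))
      map_add' := fun S T => by
        rw [← map_add]; congr 1; ext x; simp
      map_smul' := fun c T => by
        rw [← map_smul]; congr 1; ext x; simp }
  refine isMIdeal_of_approximation (A := fun n => conj (P n))
    (B := fun n => conj (ContinuousLinearMap.id 𝕜 X - P n)) (isClosed_numRadCompacts h) ?_ ?_ ?_
  · intro S hS
    have := tendsto_iff_norm_sub_tendsto_zero.1 (hP.tendsto_conj_of_isCompactOperator hS)
    rw [tendsto_iff_norm_sub_tendsto_zero]
    exact squeeze_zero (fun n => norm_nonneg _) (fun n => numericalRadius_le_norm _) this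
  · intro n T
    have hT : ι (T - conj (ContinuousLinearMap.id 𝕜 X - P n) T) =
        (P n).comp (ι T) + (ι T).comp (P n) - (P n).comp ((ι T).comp (P n)) := by
      ext x
      simp [conj]
      abel
    change IsCompactOperator (ι (T - conj (ContinuousLinearMap.id 𝕜 X - P n) T))
    rw [hT]
    have hc := hP.isCompactOperator n
    exact ((hc.comp_clm (ι T)).add (hc.clm_comp (ι T))).sub (hc.comp_clm ((ι T).comp (P n)))
  · intro n S _ T
    exact hP.numericalRadius_block_le n (ι S) (ι T)

end IsAbsoluteApproximation

end Approximation

/-! ### Sums of finite-dimensional spaces -/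

section Sums

open Filter

theorem one_lt_toReal {p : ℝ≥0∞} (hp1 : 1 < p) (hp : p < ∞) : 1 < p.toReal := by
  rw [← ENNReal.toReal_one]
  exact (ENNReal.toReal_lt_toReal ENNReal.one_ne_top hp.ne).2 hp1

variable (𝕜 : Type*) [RCLike 𝕜] (F : ℕ → Type*) [∀ i, NormedAddCommGroup (F i)]
  [∀ i, NormedSpace 𝕜 (F i)]

/-- The projection of an `ℓ_p`-sum onto its first `n` summands. -/
noncomputable def lpTruncation (p : ℝ≥0∞) [Fact (1 ≤ p)] (n : ℕ) : lp F p →L[𝕜] lp F p :=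
  ∑ i ∈ Finset.range n, (lp.singleContinuousLinearMap 𝕜 F p i).comp (lp.evalCLM 𝕜 F p i)

variable {F}

theorem lpTruncation_eq_sum (p : ℝ≥0∞) [Fact (1 ≤ p)] (n : ℕ) (x : lp F p) :
    lpTruncation 𝕜 F p n x = ∑ i ∈ Finset.range n, lp.single p i (x i) := by
  simp [lpTruncation, lp.evalCLM]

theorem lpTruncation_apply (p : ℝ≥0∞) [Fact (1 ≤ p)] (n : ℕ) (x : lp F p) (i : ℕ) :
    lpTruncation 𝕜 F p n x i = if i < n then x i else 0 := by
  rw [lpTruncation_eq_sum, lp.coeFn_sum, Finset.sum_apply]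
  simp only [lp.single_apply, Finset.sum_pi_single, Finset.mem_range]

theorem finiteDimensional_range_lpTruncation [∀ i, FiniteDimensional 𝕜 (F i)] (p : ℝ≥0∞)
    [Fact (1 ≤ p)] (n : ℕ) : FiniteDimensional 𝕜 (lpTruncation 𝕜 F p n).range := by
  let L : (∀ i : Fin n, F i) →ₗ[𝕜] lp F p :=
    ∑ i : Fin n, (lp.lsingle p (i : ℕ)).comp (LinearMap.proj i)
  refine Submodule.finiteDimensional_of_le (S₂ := LinearMap.range L) ?_
  rintro _ ⟨x, rfl⟩
  refine ⟨fun i => x i, ?_⟩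
  simp [L, lpTruncation_eq_sum, Finset.sum_range]

theorem norm_rpow_lpTruncation {p : ℝ≥0∞} [Fact (1 ≤ p)] (hp : p ≠ ∞) (n : ℕ) (x : lp F p) :
    ‖x‖ ^ p.toReal =
      ‖lpTruncation 𝕜 F p n x‖ ^ p.toReal + ‖x - lpTruncation 𝕜 F p n x‖ ^ p.toReal := by
  have hp0 : 0 < p.toReal := ENNReal.toReal_pos (zero_lt_one.trans_le Fact.out).ne' hp
  rw [lpTruncation_eq_sum, lp.norm_compl_sum_single hp0, lp.norm_sum_single hp0]
  ring

theorem isAbsoluteApproximation_lpTruncation [∀ i, FiniteDimensional 𝕜 (F i)] {p : ℝ≥0∞}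
    [Fact (1 ≤ p)] (hp1 : 1 < p) (hp : p < ∞) :
    IsAbsoluteApproximation (lpTruncation 𝕜 F p) := by
  have hr : 1 < p.toReal := one_lt_toReal hp1 hp
  have hr0 : 0 < p.toReal := zero_lt_one.trans hr
  have idem : ∀ n (x : lp F p), lpTruncation 𝕜 F p n (lpTruncation 𝕜 F p n x) =
      lpTruncation 𝕜 F p n x := by
    intro n x
    ext i
    simp only [lpTruncation_apply]
    split_ifs <;> rfl
  refine ⟨idem, finiteDimensional_range_lpTruncation 𝕜 p, fun x => ?_, fun n x y h1 h2 => ?_,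
    p.toReal, hr, fun n x y t ht0 ht1 hx hy => ?_⟩
  · simp_rw [lpTruncation_eq_sum]
    exact (lp.hasSum_single hp.ne x).tendsto_sum_nat
  · rw [← Real.rpow_le_rpow_iff (norm_nonneg _) (norm_nonneg _) hr0,
      norm_rpow_lpTruncation 𝕜 hp.ne n x, norm_rpow_lpTruncation 𝕜 hp.ne n y]
    gcongr
  · have hx1 : ‖lpTruncation 𝕜 F p n x‖ ^ p.toReal ≤ 1 :=
      (le_trans (by rw [norm_rpow_lpTruncation 𝕜 hp.ne n x]; simp; positivity)
        (Real.rpow_le_one (norm_nonneg x) hx hr0.le))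
    have hy1 : ‖y - lpTruncation 𝕜 F p n y‖ ^ p.toReal ≤ 1 :=
      (le_trans (by rw [norm_rpow_lpTruncation 𝕜 hp.ne n y]; simp; positivity)
        (Real.rpow_le_one (norm_nonneg y) hy hr0.le))
    have htr : 0 ≤ t ^ p.toReal := by positivity
    rw [← Real.rpow_le_rpow_iff (norm_nonneg _) (by positivity) hr0,
      norm_rpow_lpTruncation 𝕜 hp.ne n]
    simp only [map_add, map_smul, map_sub, idem, sub_self, smul_zero, add_zero,
      add_sub_cancel_left, norm_smul, RCLike.norm_ofReal, abs_of_pos ht0]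
    rw [Real.mul_rpow ht0.le (norm_nonneg _)]
    calc _ ≤ 1 + t ^ p.toReal * 1 := by gcongr
      _ ≤ (1 + t ^ p.toReal) ^ (1 : ℝ) := by simp
      _ ≤ (1 + t ^ p.toReal) ^ p.toReal := Real.rpow_le_rpow_of_exponent_le (by linarith) hr.le

/-- The projection of a `c₀`-sum onto its first `n` summands. -/
noncomputable def c0Truncation (n : ℕ) : c0Sum 𝕜 F →L[𝕜] c0Sum 𝕜 F :=
  ((lpTruncation 𝕜 F ∞ n).comp (c0Sum 𝕜 F).subtypeL).codRestrict (c0Sum 𝕜 F) fun x => by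
    refine tendsto_const_nhds.congr' ?_
    filter_upwards [eventually_ge_atTop n] with i hi
    simp [lpTruncation_apply, not_lt.2 hi]

theorem coe_c0Truncation (n : ℕ) (x : c0Sum 𝕜 F) :
    (c0Truncation 𝕜 n x : lp F ∞) = lpTruncation 𝕜 F ∞ n x := rfl

theorem c0Truncation_apply (n : ℕ) (x : c0Sum 𝕜 F) (i : ℕ) :
    (c0Truncation 𝕜 n x : lp F ∞) i = if i < n then (x : lp F ∞) i else 0 := by
  rw [coe_c0Truncation, lpTruncation_apply]

variable {𝕜} in
theorem norm_le_of_forall_apply_le {x : c0Sum 𝕜 F} {C : ℝ} (hC : 0 ≤ C)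
    (h : ∀ i, ‖(x : lp F ∞) i‖ ≤ C) : ‖x‖ ≤ C :=
  lp.norm_le_of_forall_le hC h

variable {𝕜} in
theorem norm_apply_le_norm_c0Sum (x : c0Sum 𝕜 F) (i : ℕ) : ‖(x : lp F ∞) i‖ ≤ ‖x‖ :=
  lp.norm_apply_le_norm (by simp) (x : lp F ∞) i

theorem norm_le_of_c0Truncation_le {n : ℕ} {x : c0Sum 𝕜 F} {C : ℝ}
    (h1 : ‖c0Truncation 𝕜 n x‖ ≤ C) (h2 : ‖x - c0Truncation 𝕜 n x‖ ≤ C) : ‖x‖ ≤ C := by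
  refine norm_le_of_forall_apply_le ((norm_nonneg _).trans h1) fun i => ?_
  by_cases hi : i < n
  · refine le_trans ?_ ((norm_apply_le_norm_c0Sum _ i).trans h1)
    simp [c0Truncation_apply, hi]
  · refine le_trans ?_ ((norm_apply_le_norm_c0Sum _ i).trans h2)
    simp [c0Truncation_apply, hi]

theorem norm_c0Truncation_le (n : ℕ) (x : c0Sum 𝕜 F) : ‖c0Truncation 𝕜 n x‖ ≤ ‖x‖ := by
  refine norm_le_of_forall_apply_le (norm_nonneg x) fun i => ?_
  rw [c0Truncation_apply]
  split_ifs
  · exact norm_apply_le_norm_c0Sum x i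
  · simp

theorem norm_sub_c0Truncation_le (n : ℕ) (x : c0Sum 𝕜 F) : ‖x - c0Truncation 𝕜 n x‖ ≤ ‖x‖ := by
  refine norm_le_of_forall_apply_le (norm_nonneg x) fun i => ?_
  by_cases hi : i < n
  · simp [c0Truncation_apply, hi]
  · simpa [c0Truncation_apply, hi] using norm_apply_le_norm_c0Sum x i

theorem isAbsoluteApproximation_c0Truncation [∀ i, FiniteDimensional 𝕜 (F i)] :
    IsAbsoluteApproximation (c0Truncation 𝕜 (F := F)) := by
  have idem : ∀ n (x : c0Sum 𝕜 F), c0Truncation 𝕜 n (c0Truncation 𝕜 n x) =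
      c0Truncation 𝕜 n x := by
    intro n x
    ext i
    simp only [c0Truncation_apply]
    split_ifs <;> rfl
  refine ⟨idem, fun n => ?_, fun x => ?_, fun n x y h1 h2 => ?_,
    2, one_lt_two, fun n x y t ht0 ht1 hx hy => ?_⟩
  · have := finiteDimensional_range_lpTruncation 𝕜 (F := F) ∞ n
    let L : (c0Truncation 𝕜 (F := F) n).range →ₗ[𝕜] (lpTruncation 𝕜 F ∞ n).range :=
      LinearMap.restrict (c0Sum 𝕜 F).subtype (by rintro _ ⟨x, rfl⟩; exact ⟨x, rfl⟩)
    refine FiniteDimensional.of_injective L fun x y h => ?_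
    have h' : ((x : c0Sum 𝕜 F) : lp F ∞) = (y : c0Sum 𝕜 F) :=
      congrArg (fun z : (lpTruncation 𝕜 F ∞ n).range => (z : lp F ∞)) h
    exact Subtype.ext (Subtype.ext h')
  · rw [tendsto_iff_norm_sub_tendsto_zero, Metric.tendsto_atTop]
    intro ε hε
    have hx : Tendsto (fun i => ‖(x : lp F ∞) i‖) atTop (𝓝 0) := x.2
    obtain ⟨N, hN⟩ := eventually_atTop.1 (hx.eventually (gt_mem_nhds (half_pos hε)))
    refine ⟨N, fun n hn => ?_⟩
    rw [dist_zero_right, norm_norm]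
    refine (norm_le_of_forall_apply_le (half_pos hε).le fun i => ?_).trans_lt (half_lt_self hε)
    by_cases hi : i < n
    · simpa [c0Truncation_apply, hi] using (half_pos hε).le
    · simpa [c0Truncation_apply, hi] using (hN i (hn.trans (not_lt.1 hi))).le
  · exact norm_le_of_c0Truncation_le 𝕜 (h1.trans (norm_c0Truncation_le 𝕜 n x))
      (h2.trans (norm_sub_c0Truncation_le 𝕜 n x))
  · refine norm_le_of_c0Truncation_le 𝕜 (n := n) ?_ ?_
    · simp only [map_add, map_smul, map_sub, idem, sub_self, smul_zero, add_zero]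
      exact ((norm_c0Truncation_le 𝕜 n x).trans hx).trans (by simp; positivity)
    · simp only [map_add, map_smul, map_sub, idem, sub_self, smul_zero, add_zero,
        add_sub_cancel_left, norm_smul, RCLike.norm_ofReal, abs_of_pos ht0]
      have h1 := (norm_sub_c0Truncation_le 𝕜 n y).trans hy
      have h2 : 0 ≤ t ^ (2 : ℝ) := by positivity
      have h3 : t * ‖y - c0Truncation 𝕜 n y‖ ≤ 1 := mul_le_one₀ ht1 (norm_nonneg _) h1
      linarith

theorem isClosed_c0Sum : IsClosed (c0Sum 𝕜 F : Set (lp F ∞)) := by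
  refine isClosed_of_closure_subset fun x hx => ?_
  change Tendsto (fun i => ‖x i‖) atTop (𝓝 0)
  rw [Metric.tendsto_nhds]
  intro ε hε
  obtain ⟨y, hy, hxy⟩ := Metric.mem_closure_iff.1 hx (ε / 2) (half_pos hε)
  have hy' : Tendsto (fun i => ‖y i‖) atTop (𝓝 0) := hy
  filter_upwards [hy'.eventually (gt_mem_nhds (half_pos hε))] with i hi
  rw [dist_zero_right, norm_norm]
  rw [dist_eq_norm] at hxy
  have h1 : ‖x i - y i‖ ≤ ‖x - y‖ := lp.norm_apply_le_norm (by simp) (x - y) i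
  have h2 := norm_le_norm_add_norm_sub' (x i) (y i)
  linarith

instance [∀ i, CompleteSpace (F i)] : CompleteSpace (c0Sum 𝕜 F) :=
  (isClosed_c0Sum 𝕜).completeSpace_coe

end Sums

/-! ### The numerical index of `ℓ_p` -/

section DualityMap

variable {𝕜 : Type*} [RCLike 𝕜]

/-- The duality map `z ↦ |z|^{r-2} conj z` of the scalars with gauge `t ↦ t^{r-1}`, where `1 < r`.
At `z = 0` its value is `0`, also for `r < 2`. -/
noncomputable def dualityMap (r : ℝ) (z : 𝕜) : 𝕜 :=
  ((‖z‖ ^ (r - 2) : ℝ) : 𝕜) * (starRingEnd 𝕜) z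

@[simp]
theorem dualityMap_zero (r : ℝ) : dualityMap r (0 : 𝕜) = 0 := by simp [dualityMap]

@[simp]
theorem dualityMap_one (r : ℝ) : dualityMap r (1 : 𝕜) = 1 := by simp [dualityMap]

theorem dualityMap_mul (r : ℝ) (c z : 𝕜) :
    dualityMap r (c * z) = dualityMap r c * dualityMap r z := by
  simp only [dualityMap, norm_mul, Real.mul_rpow (norm_nonneg c) (norm_nonneg z), map_mul]
  ring

theorem norm_dualityMap {r : ℝ} (hr : 1 < r) (z : 𝕜) : ‖dualityMap r z‖ = ‖z‖ ^ (r - 1) := by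
  rcases eq_or_ne z 0 with rfl | hz
  · simp [Real.zero_rpow (by linarith : r - 1 ≠ 0)]
  · have hz' : 0 < ‖z‖ := norm_pos_iff.2 hz
    rw [dualityMap, norm_mul, RCLike.norm_conj, RCLike.norm_ofReal,
      abs_of_nonneg (by positivity), ← Real.rpow_add_one hz'.ne']
    congr 1; ring

theorem dualityMap_mul_self {r : ℝ} (hr : 1 < r) (z : 𝕜) :
    dualityMap r z * z = ((‖z‖ ^ r : ℝ) : 𝕜) := by
  rcases eq_or_ne z 0 with rfl | hz
  · simp [Real.zero_rpow (by linarith : r ≠ 0)]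
  · have hz' : 0 < ‖z‖ := norm_pos_iff.2 hz
    rw [dualityMap, mul_assoc, RCLike.conj_mul, ← RCLike.ofReal_pow, ← RCLike.ofReal_mul,
      ← Real.rpow_natCast, ← Real.rpow_add hz']
    congr 2; norm_num

theorem norm_le_abs_re_add_abs_im (z : 𝕜) : ‖z‖ ≤ |RCLike.re z| + |RCLike.im z| := by
  refine abs_le_of_sq_le_sq' ?_ (by positivity) |>.2
  rw [RCLike.norm_sq_eq_def]
  nlinarith [abs_mul_abs_self (RCLike.re z), abs_mul_abs_self (RCLike.im z),
    mul_nonneg (abs_nonneg (RCLike.re z)) (abs_nonneg (RCLike.im z))]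

end DualityMap

section LpIndex

variable {𝕜 : Type*} [RCLike 𝕜] {p : ℝ≥0∞}

theorem rpow_sub_one_mul_self {r : ℝ} (hr : 1 < r) {a : ℝ} (ha : 0 ≤ a) :
    a ^ (r - 1) * a = a ^ r := by
  rcases ha.eq_or_lt with rfl | ha
  · simp [Real.zero_rpow (by linarith : r ≠ 0)]
  · rw [← Real.rpow_add_one ha.ne']; congr 1; ring

/-- Hölder's inequality for the `(p-1)`-st powers of the coordinates of one vector and the
coordinates of another. -/
theorem lp.exists_hasSum_rpow_mul_le (hp : 1 < p.toReal) (x y : lp (fun _ : ℕ => 𝕜) p) :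
    ∃ C, C ≤ ‖x‖ ^ (p.toReal - 1) * ‖y‖ ∧
      HasSum (fun i => ‖x i‖ ^ (p.toReal - 1) * ‖y i‖) C := by
  have hp0 : 0 < p.toReal := by linarith
  have hpq := Real.HolderConjugate.conjExponent hp
  have hexp : ∀ a : ℝ, 0 ≤ a →
      (a ^ (p.toReal - 1)) ^ p.toReal.conjExponent = a ^ p.toReal := fun a ha => by
    rw [← Real.rpow_mul ha, hpq.sub_one_mul_conj]
  obtain ⟨C, -, hC, hC'⟩ := Real.inner_le_Lp_mul_Lq_hasSum_of_nonneg hpq.symm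
    (f := fun i => ‖x i‖ ^ (p.toReal - 1)) (g := fun i => ‖y i‖)
    (A := ‖x‖ ^ (p.toReal - 1)) (B := ‖y‖)
    (Real.rpow_nonneg (lp.norm_nonneg' x) _) (lp.norm_nonneg' y)
    (fun i => by positivity) (fun i => norm_nonneg _)
    (by
      simp_rw [hexp _ (norm_nonneg _)]
      rw [hexp _ (lp.norm_nonneg' x)]
      exact lp.hasSum_norm hp0 x)
    (lp.hasSum_norm hp0 y)
  exact ⟨C, hC, hC'⟩

theorem lp.summable_dualityMap_mul (hp : 1 < p.toReal) (x y : lp (fun _ : ℕ => 𝕜) p) :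
    Summable fun i => dualityMap p.toReal (x i) * y i := by
  obtain ⟨C, -, hC⟩ := lp.exists_hasSum_rpow_mul_le hp x y
  refine Summable.of_norm (hC.summable.congr fun i => ?_)
  rw [norm_mul, norm_dualityMap hp]

/-- The restriction of a sequence in `ℓ_p` to a set of coordinates, extended by zero. -/
noncomputable def lpIndicator (B : Set ℕ) (x : lp (fun _ : ℕ => 𝕜) p) : lp (fun _ : ℕ => 𝕜) p :=
  ⟨B.indicator x, (lp.memℓp x).mono' fun _ => norm_indicator_le_norm_self _ _⟩

theorem lpIndicator_apply (B : Set ℕ) (x : lp (fun _ : ℕ => 𝕜) p) (i : ℕ) :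
    lpIndicator B x i = B.indicator x i := rfl

theorem lpIndicator_add_compl (B : Set ℕ) (x : lp (fun _ : ℕ => 𝕜) p) :
    lpIndicator B x + lpIndicator Bᶜ x = x := by
  ext i
  simp only [lp.coeFn_add, Pi.add_apply, lpIndicator_apply]
  exact congrFun (Set.indicator_self_add_compl B x) i

variable [Fact (1 ≤ p)]

/-- The functional `y ↦ ∑ |x i|^{p-2} conj (x i) (y i)` on `ℓ_p`, which attains its norm at `x`. -/
noncomputable def lpDuality (hp : 1 < p.toReal) (x : lp (fun _ : ℕ => 𝕜) p) :
    StrongDual 𝕜 (lp (fun _ : ℕ => 𝕜) p) :=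
  LinearMap.mkContinuous
    { toFun := fun y => ∑' i, dualityMap p.toReal (x i) * y i
      map_add' := fun y z => by
        rw [← (lp.summable_dualityMap_mul hp x y).tsum_add (lp.summable_dualityMap_mul hp x z)]
        simp [mul_add]
      map_smul' := fun c y => by
        simp only [lp.coeFn_smul, Pi.smul_apply, smul_eq_mul, RingHom.id_apply, ← tsum_mul_left]
        congr 1; ext i; ring }
    (‖x‖ ^ (p.toReal - 1)) fun y => by
      obtain ⟨C, hC, hC'⟩ := lp.exists_hasSum_rpow_mul_le hp x y
      refine (tsum_of_norm_bounded hC' fun i => ?_).trans hC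
      rw [norm_mul, norm_dualityMap hp]

theorem hasSum_lpDuality (hp : 1 < p.toReal) (x y : lp (fun _ : ℕ => 𝕜) p) :
    HasSum (fun i => dualityMap p.toReal (x i) * y i) (lpDuality hp x y) :=
  (lp.summable_dualityMap_mul hp x y).hasSum

theorem norm_lpDuality_apply_le_numericalRadius (hp : 1 < p.toReal)
    (T : lp (fun _ : ℕ => 𝕜) p →L[𝕜] lp (fun _ : ℕ => 𝕜) p) (x : lp (fun _ : ℕ => 𝕜) p) :
    ‖lpDuality hp x (T x)‖ ≤ numericalRadius T * ‖x‖ ^ p.toReal := by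
  have hself : lpDuality hp x x = ((‖x‖ ^ p.toReal : ℝ) : 𝕜) := by
    refine (hasSum_lpDuality hp x x).unique ?_
    simp_rw [dualityMap_mul_self hp]
    exact RCLike.ofRealCLM.hasSum (lp.hasSum_norm (by linarith) x)
  have hle : ‖lpDuality hp x‖ ≤ ‖x‖ ^ (p.toReal - 1) :=
    LinearMap.mkContinuous_norm_le _ (by positivity) _
  have hnorm : ‖lpDuality hp x‖ * ‖x‖ = ‖x‖ ^ p.toReal := by
    refine le_antisymm ?_ ?_
    · rw [← rpow_sub_one_mul_self hp (norm_nonneg x)]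
      gcongr
    · have := (lpDuality hp x).le_opNorm x
      rwa [hself, RCLike.norm_ofReal, abs_of_nonneg (by positivity)] at this
  rw [← hnorm] at hself ⊢
  exact norm_apply_le_numericalRadius T hself

theorem lpDuality_add_smul (hp : 1 < p.toReal) {a b : lp (fun _ : ℕ => 𝕜) p}
    (hab : ∀ i, a i = 0 ∨ b i = 0) (c : 𝕜) (y : lp (fun _ : ℕ => 𝕜) p) :
    lpDuality hp (a + c • b) y =
      lpDuality hp a y + dualityMap p.toReal c * lpDuality hp b y := by
  refine (hasSum_lpDuality hp _ y).unique ?_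
  convert (hasSum_lpDuality hp a y).add
    ((hasSum_lpDuality hp b y).mul_left (dualityMap p.toReal c)) using 2 with i
  simp only [lp.coeFn_add, lp.coeFn_smul, Pi.add_apply, Pi.smul_apply, smul_eq_mul]
  rcases hab i with h | h <;> simp [h, dualityMap_mul, mul_assoc]

/-- Testing `T` on `a + c b` bounds a combination of its two off-diagonal values. -/
theorem norm_lpDuality_cross_le (hp : 1 < p.toReal)
    (T : lp (fun _ : ℕ => 𝕜) p →L[𝕜] lp (fun _ : ℕ => 𝕜) p) {a b : lp (fun _ : ℕ => 𝕜) p}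
    (hab : ∀ i, a i = 0 ∨ b i = 0) {R : ℝ} (ha : ‖a‖ ≤ R) (hb : ‖b‖ ≤ R) (c : 𝕜) :
    ‖c * lpDuality hp a (T b) + dualityMap p.toReal c * lpDuality hp b (T a)‖ ≤
      ((R + ‖c‖ * R) ^ p.toReal + R ^ p.toReal + ‖c‖ ^ p.toReal * R ^ p.toReal) *
        numericalRadius T := by
  have hv := numericalRadius_nonneg T
  have h1 := norm_lpDuality_apply_le_numericalRadius hp T (a + c • b)
  have h2 := norm_lpDuality_apply_le_numericalRadius hp T a
  have h3 := norm_lpDuality_apply_le_numericalRadius hp T b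
  have hz : ‖a + c • b‖ ≤ R + ‖c‖ * R := (norm_add_le _ _).trans (by rw [norm_smul]; gcongr)
  have hexp : c * lpDuality hp a (T b) + dualityMap p.toReal c * lpDuality hp b (T a) =
      lpDuality hp (a + c • b) (T (a + c • b)) - lpDuality hp a (T a) -
        (dualityMap p.toReal c * c) * lpDuality hp b (T b) := by
    rw [lpDuality_add_smul hp hab]
    simp only [map_add, map_smul, smul_eq_mul]
    ring
  have hc : ‖dualityMap p.toReal c * c‖ = ‖c‖ ^ p.toReal := by
    rw [dualityMap_mul_self hp, RCLike.norm_ofReal, abs_of_nonneg (by positivity)]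
  rw [hexp]
  calc _ ≤ ‖lpDuality hp (a + c • b) (T (a + c • b))‖ + ‖lpDuality hp a (T a)‖ +
        ‖(dualityMap p.toReal c * c) * lpDuality hp b (T b)‖ :=
        (norm_sub_le _ _).trans (add_le_add (norm_sub_le _ _) le_rfl)
    _ ≤ numericalRadius T * (R + ‖c‖ * R) ^ p.toReal + numericalRadius T * R ^ p.toReal +
        ‖c‖ ^ p.toReal * (numericalRadius T * R ^ p.toReal) := by
      rw [norm_mul, hc]
      gcongr
      · exact h1.trans (by gcongr)
      · exact h2.trans (by gcongr)
      · exact h3.trans (by gcongr)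
    _ = _ := by ring

/-- If the duality map does not fix `β`, the coefficients `1` and `β` yield independent
combinations of the two off-diagonal values, so both values are controlled by the numerical
radius. -/
theorem exists_norm_lpDuality_le (hp : 1 < p.toReal) {β : 𝕜} (hβ : dualityMap p.toReal β ≠ β)
    {R : ℝ} (hR : 0 ≤ R) :
    ∃ K : ℝ, 0 ≤ K ∧ ∀ (T : lp (fun _ : ℕ => 𝕜) p →L[𝕜] lp (fun _ : ℕ => 𝕜) p)
      (a b : lp (fun _ : ℕ => 𝕜) p), (∀ i, a i = 0 ∨ b i = 0) → ‖a‖ ≤ R → ‖b‖ ≤ R →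
        ‖lpDuality hp b (T a)‖ ≤ K * numericalRadius T := by
  let C : 𝕜 → ℝ := fun c =>
    (R + ‖c‖ * R) ^ p.toReal + R ^ p.toReal + ‖c‖ ^ p.toReal * R ^ p.toReal
  have hpos : 0 < ‖β - dualityMap p.toReal β‖ := norm_pos_iff.2 (sub_ne_zero.2 hβ.symm)
  refine ⟨(‖β‖ * C 1 + C β) / ‖β - dualityMap p.toReal β‖, by positivity, ?_⟩
  intro T a b hab ha hb
  have h1 := norm_lpDuality_cross_le hp T hab ha hb 1
  have h2 := norm_lpDuality_cross_le hp T hab ha hb β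
  rw [dualityMap_one, one_mul, one_mul] at h1
  rw [div_mul_eq_mul_div, le_div_iff₀ hpos, mul_comm, ← norm_mul]
  have : (β - dualityMap p.toReal β) * lpDuality hp b (T a) =
      β * (lpDuality hp a (T b) + lpDuality hp b (T a)) -
        (β * lpDuality hp a (T b) + dualityMap p.toReal β * lpDuality hp b (T a)) := by ring
  rw [this, add_mul, mul_assoc]
  refine (norm_sub_le _ _).trans (add_le_add ?_ h2)
  rw [norm_mul]
  exact mul_le_mul_of_nonneg_left h1 (norm_nonneg _)

theorem norm_lpIndicator_le (B : Set ℕ) (x : lp (fun _ : ℕ => 𝕜) p) : ‖lpIndicator B x‖ ≤ ‖x‖ :=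
  lp.norm_mono (zero_lt_one.trans_le Fact.out).ne' fun _ => norm_indicator_le_norm_self _ _

/-- Splitting `x` according to the sign of `L` on the terms of the pairing of `x` with `T x`
bounds the absolute sum of these real numbers by the numerical radius. -/
theorem summable_abs_and_tsum_le (hp : 1 < p.toReal)
    {T : lp (fun _ : ℕ => 𝕜) p →L[𝕜] lp (fun _ : ℕ => 𝕜) p} {K R : ℝ}
    (hK : ∀ a b : lp (fun _ : ℕ => 𝕜) p, (∀ i, a i = 0 ∨ b i = 0) → ‖a‖ ≤ R → ‖b‖ ≤ R →
        ‖lpDuality hp b (T a)‖ ≤ K * numericalRadius T)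
    {L : 𝕜 →L[ℝ] ℝ} (hL : ∀ z, |L z| ≤ ‖z‖) {x : lp (fun _ : ℕ => 𝕜) p} (hx : ‖x‖ ≤ R) :
    (Summable fun i => |L (dualityMap p.toReal (x i) * T x i)|) ∧
      ∑' i, |L (dualityMap p.toReal (x i) * T x i)| ≤
        (2 * R ^ p.toReal + 2 * K) * numericalRadius T := by
  -- on `B` the vector `x` agrees with `a`, off `B` with `b`
  let B : Set ℕ := {i | 0 ≤ L (dualityMap p.toReal (x i) * T x i)}
  set a := lpIndicator B x with ha
  set b := lpIndicator Bᶜ x with hb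
  have haR : ‖a‖ ≤ R := (norm_lpIndicator_le B x).trans hx
  have hbR : ‖b‖ ≤ R := (norm_lpIndicator_le Bᶜ x).trans hx
  have hab : ∀ i, a i = 0 ∨ b i = 0 := by
    intro i
    by_cases hi : i ∈ B
    · exact Or.inr (by rw [hb, lpIndicator_apply]; simp [hi])
    · exact Or.inl (by rw [ha, lpIndicator_apply]; simp [hi])
  have hxab : a + b = x := lpIndicator_add_compl B x
  have hsum : HasSum (fun i => |L (dualityMap p.toReal (x i) * T x i)|)
      (L (lpDuality hp a (T x) - lpDuality hp b (T x))) := by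
    have := L.hasSum ((hasSum_lpDuality hp a (T x)).sub (hasSum_lpDuality hp b (T x)))
    refine this.congr_fun fun i => ?_
    by_cases hi : i ∈ B
    · simp only [ha, hb, lpIndicator_apply]
      simp [hi, abs_of_nonneg (show 0 ≤ L (dualityMap p.toReal (x i) * T x i) from hi)]
    · simp only [ha, hb, lpIndicator_apply]
      simp [hi, abs_of_neg (not_le.1 (show ¬ 0 ≤ L (dualityMap p.toReal (x i) * T x i) from hi))]
  refine ⟨hsum.summable, ?_⟩
  rw [hsum.tsum_eq]
  have hv := numericalRadius_nonneg T
  have e1 : ‖lpDuality hp a (T a)‖ ≤ numericalRadius T * R ^ p.toReal :=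
    (norm_lpDuality_apply_le_numericalRadius hp T a).trans (by gcongr)
  have e2 : ‖lpDuality hp b (T b)‖ ≤ numericalRadius T * R ^ p.toReal :=
    (norm_lpDuality_apply_le_numericalRadius hp T b).trans (by gcongr)
  have e3 := hK a b hab haR hbR
  have e4 := hK b a (fun i => (hab i).symm) hbR haR
  have e5 : lpDuality hp a (T x) - lpDuality hp b (T x) =
      (lpDuality hp a (T a) + lpDuality hp a (T b)) -
        (lpDuality hp b (T a) + lpDuality hp b (T b)) := by
    rw [← hxab]; simp only [map_add]
  calc _ ≤ ‖lpDuality hp a (T x) - lpDuality hp b (T x)‖ := (le_abs_self _).trans (hL _)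
    _ ≤ (‖lpDuality hp a (T a)‖ + ‖lpDuality hp a (T b)‖) +
        (‖lpDuality hp b (T a)‖ + ‖lpDuality hp b (T b)‖) := by
      rw [e5]
      exact (norm_sub_le _ _).trans (add_le_add (norm_add_le _ _) (norm_add_le _ _))
    _ ≤ _ := by linarith

/-- The numerical radius controls the absolute numerical radius `sup ∑ |x i|^{p-1} |(T x) i|`. -/
theorem exists_absolute_numericalRadius_le (hp : 1 < p.toReal) {β : 𝕜}
    (hβ : dualityMap p.toReal β ≠ β) {R : ℝ} (hR : 0 ≤ R) :
    ∃ M : ℝ, 0 < M ∧ ∀ (T : lp (fun _ : ℕ => 𝕜) p →L[𝕜] lp (fun _ : ℕ => 𝕜) p)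
      (x : lp (fun _ : ℕ => 𝕜) p), ‖x‖ ≤ R →
        ∑' i, ‖x i‖ ^ (p.toReal - 1) * ‖T x i‖ ≤ M * numericalRadius T := by
  obtain ⟨K, hK0, hK⟩ := exists_norm_lpDuality_le hp hβ hR
  refine ⟨2 * (2 * R ^ p.toReal + 2 * K) + 1, by positivity, fun T x hx => ?_⟩
  obtain ⟨s1, b1⟩ := summable_abs_and_tsum_le hp (hK T) (L := RCLike.reCLM)
    (fun z => RCLike.abs_re_le_norm z) hx
  obtain ⟨s2, b2⟩ := summable_abs_and_tsum_le hp (hK T) (L := RCLike.imCLM)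
    (fun z => RCLike.abs_im_le_norm z) hx
  obtain ⟨C, -, hC⟩ := lp.exists_hasSum_rpow_mul_le hp x (T x)
  have hv := numericalRadius_nonneg T
  calc _ ≤ ∑' i, (|RCLike.reCLM (dualityMap p.toReal (x i) * T x i)| +
        |RCLike.imCLM (dualityMap p.toReal (x i) * T x i)|) := by
        refine hC.summable.tsum_le_tsum (fun i => ?_) (s1.add s2)
        rw [← norm_dualityMap hp, ← norm_mul]
        exact norm_le_abs_re_add_abs_im _
    _ ≤ (2 * R ^ p.toReal + 2 * K) * numericalRadius T +
        (2 * R ^ p.toReal + 2 * K) * numericalRadius T := by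
      rw [s1.tsum_add s2]
      exact add_le_add b1 b2
    _ ≤ _ := by linarith

/-- The absolute numerical radius dominates the operator norm: if `y = T x`, the vectors
`x ± 2 y 1_{|x| < |y|}` have coordinates at least as large as those of `y`, and their images under
`T` have the mean `y`. -/
theorem norm_apply_rpow_le (hp : 1 < p.toReal)
    {T : lp (fun _ : ℕ => 𝕜) p →L[𝕜] lp (fun _ : ℕ => 𝕜) p} (hT : ‖T‖ ≤ 1) {C : ℝ}
    (hC : ∀ x : lp (fun _ : ℕ => 𝕜) p, ‖x‖ ≤ 3 →
      ∑' i, ‖x i‖ ^ (p.toReal - 1) * ‖T x i‖ ≤ C)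
    {x : lp (fun _ : ℕ => 𝕜) p} (hx : ‖x‖ ≤ 1) : ‖T x‖ ^ p.toReal ≤ C := by
  set y := T x with hy
  have hy1 : ‖y‖ ≤ 1 := by
    simpa using (T.le_opNorm x).trans (mul_le_mul hT hx (norm_nonneg _) zero_le_one)
  set w := (2 : 𝕜) • lpIndicator {i | ‖x i‖ < ‖y i‖} y with hw
  have hw2 : ‖w‖ ≤ 2 := by
    rw [hw, norm_smul, RCLike.norm_ofNat]
    linarith [norm_lpIndicator_le {i | ‖x i‖ < ‖y i‖} y]
  have hwi : ∀ i, ‖y i‖ ≤ ‖x i + w i‖ ∧ ‖y i‖ ≤ ‖x i - w i‖ := by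
    intro i
    by_cases hi : ‖x i‖ < ‖y i‖
    · have hwy : w i = 2 * y i := by
        rw [hw, lp.coeFn_smul, Pi.smul_apply, lpIndicator_apply, smul_eq_mul]
        exact congrArg _ (Set.indicator_of_mem (s := {i | ‖x i‖ < ‖y i‖}) hi _)
      have hn : ‖w i‖ = 2 * ‖y i‖ := by rw [hwy, norm_mul, RCLike.norm_ofNat]
      constructor
      · have := norm_sub_le (x i + w i) (x i)
        rw [add_sub_cancel_left] at this
        linarith
      · have := norm_sub_le (x i) (x i - w i)
        rw [sub_sub_cancel] at this
        linarith
    · have hw0 : w i = 0 := by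
        rw [hw, lp.coeFn_smul, Pi.smul_apply, lpIndicator_apply, smul_eq_mul]
        exact mul_eq_zero_of_right _ (Set.indicator_of_notMem (s := {i | ‖x i‖ < ‖y i‖}) hi _)
      simpa [hw0] using not_lt.1 hi
  have h1 := hC (x + w) ((norm_add_le _ _).trans (by linarith))
  have h2 := hC (x - w) ((norm_sub_le _ _).trans (by linarith))
  obtain ⟨C1, -, hC1⟩ := lp.exists_hasSum_rpow_mul_le hp (x + w) (T (x + w))
  obtain ⟨C2, -, hC2⟩ := lp.exists_hasSum_rpow_mul_le hp (x - w) (T (x - w))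
  rw [hC1.tsum_eq] at h1
  rw [hC2.tsum_eq] at h2
  have hr : 0 ≤ p.toReal - 1 := by linarith
  have key := hasSum_le (fun i => ?_)
    ((lp.hasSum_norm (by linarith) y).mul_left 2) (hC1.add hC2)
  · linarith
  · have hyi : 2 * ‖y i‖ ≤ ‖T (x + w) i‖ + ‖T (x - w) i‖ := by
      have : (2 : 𝕜) * y i = T (x + w) i + T (x - w) i := by
        rw [← Pi.add_apply, ← lp.coeFn_add, ← map_add, add_add_sub_cancel, map_add, ← hy]
        simp [two_mul]
      calc 2 * ‖y i‖ = ‖(2 : 𝕜) * y i‖ := by rw [norm_mul, RCLike.norm_ofNat]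
        _ ≤ _ := by rw [this]; exact norm_add_le _ _
    rw [← rpow_sub_one_mul_self hp (norm_nonneg (y i))]
    calc _ = ‖y i‖ ^ (p.toReal - 1) * (2 * ‖y i‖) := by ring
      _ ≤ ‖y i‖ ^ (p.toReal - 1) * (‖T (x + w) i‖ + ‖T (x - w) i‖) := by gcongr
      _ ≤ _ := by
        rw [mul_add]
        have e := hwi i
        refine add_le_add ?_ ?_ <;> gcongr
        · exact e.1
        · exact e.2

theorem numericalIndex_lp_pos (hp : 1 < p.toReal) {β : 𝕜} (hβ : dualityMap p.toReal β ≠ β) :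
    0 < numericalIndex 𝕜 (lp (fun _ : ℕ => 𝕜) p) := by
  -- the vectors used in `norm_apply_rpow_le` have norm at most `3`
  obtain ⟨M, hM, hMT⟩ := exists_absolute_numericalRadius_le hp hβ (R := 3) (by norm_num)
  have : Nontrivial (lp (fun _ : ℕ => 𝕜) p) :=
    ⟨lp.single p 0 1, 0, fun h => by
      simpa using congrArg (fun x => (x : lp (fun _ : ℕ => 𝕜) p) 0) h⟩
  have hpos : 0 < (1 / 2 : ℝ) ^ p.toReal / M := by positivity
  refine hpos.trans_le
    (le_csInf ⟨_, ContinuousLinearMap.id 𝕜 _, ContinuousLinearMap.norm_id, rfl⟩ ?_)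
  rintro _ ⟨T, hT, rfl⟩
  have hT' : ‖T‖ = 1 := hT
  obtain ⟨x, hx, hxT⟩ := T.exists_lt_apply_of_lt_opNorm (r := 1 / 2) (by rw [hT']; norm_num)
  rw [div_le_iff₀' hM]
  exact (Real.rpow_le_rpow (by norm_num) hxT.le (by linarith)).trans
    (norm_apply_rpow_le hp hT'.le (hMT T) hx.le)

end LpIndex

/-! ### M-ideals of compact operators -/

section

variable (𝕜 : Type*) [RCLike 𝕜] (F : ℕ → Type*) [∀ i, NormedAddCommGroup (F i)]
  [∀ i, NormedSpace 𝕜 (F i)] [∀ i, FiniteDimensional 𝕜 (F i)]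

theorem isMIdeal_numRadCompacts_lp {p : ℝ≥0∞} [Fact (1 ≤ p)] (hp1 : 1 < p) (hp : p < ∞)
    (h : 0 < numericalIndex 𝕜 (lp F p)) : IsMIdeal (numRadCompacts 𝕜 (lp F p)) := by
  have : ∀ i, CompleteSpace (F i) := fun i => FiniteDimensional.complete 𝕜 (F i)
  exact (isAbsoluteApproximation_lpTruncation 𝕜 hp1 hp).isMIdeal_numRadCompacts h

theorem isMIdeal_numRadCompacts_c0Sum (h : 0 < numericalIndex 𝕜 (c0Sum 𝕜 F)) :
    IsMIdeal (numRadCompacts 𝕜 (c0Sum 𝕜 F)) := by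
  have : ∀ i, CompleteSpace (F i) := fun i => FiniteDimensional.complete 𝕜 (F i)
  exact (isAbsoluteApproximation_c0Truncation 𝕜).isMIdeal_numRadCompacts h

end

theorem numericalIndex_lp_complex_pos {p : ℝ≥0∞} [Fact (1 ≤ p)] (hp1 : 1 < p) (hp : p < ∞) :
    0 < numericalIndex ℂ (lp (fun _ : ℕ => ℂ) p) := by
  refine numericalIndex_lp_pos (one_lt_toReal hp1 hp) (β := Complex.I) fun h => ?_
  -- the duality map conjugates `I`, whatever `p` is
  have := congrArg Complex.im h
  simp [dualityMap] at this
  norm_num at this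

theorem numericalIndex_lp_real_pos {p : ℝ≥0∞} [Fact (1 ≤ p)] (hp1 : 1 < p) (hp : p < ∞)
    (hp2 : p ≠ 2) : 0 < numericalIndex ℝ (lp (fun _ : ℕ => ℝ) p) := by
  refine numericalIndex_lp_pos (one_lt_toReal hp1 hp) (β := (2 : ℝ)) fun h => hp2 ?_
  -- the duality map multiplies `2` by `2 ^ (p - 2)`
  have h1 : (2 : ℝ) ^ (p.toReal - 2) = 1 := by simpa [dualityMap] using h
  have h2 : p.toReal - 2 = 0 := by
    have h3 := congrArg Real.log h1
    rw [Real.log_rpow two_pos, Real.log_one] at h3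
    exact (mul_eq_zero.1 h3).resolve_right (Real.log_pos one_lt_two).ne'
  rw [← ENNReal.ofReal_toReal hp.ne, sub_eq_zero.1 h2]
  simp

theorem mainTheorem1 :
    -- sums of finite-dimensional spaces, over the real or complex scalars
    (∀ (𝕜 : Type*) [RCLike 𝕜] (F : ℕ → Type*) [∀ i, NormedAddCommGroup (F i)]
      [∀ i, NormedSpace 𝕜 (F i)] [∀ i, FiniteDimensional 𝕜 (F i)],
      (∀ (p : ℝ≥0∞) [Fact (1 ≤ p)], 1 < p → p < ∞ →
        0 < numericalIndex 𝕜 (lp F p) → IsMIdeal (numRadCompacts 𝕜 (lp F p))) ∧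
      (0 < numericalIndex 𝕜 (c0Sum 𝕜 F) → IsMIdeal (numRadCompacts 𝕜 (c0Sum 𝕜 F)))) ∧
    -- the complex spaces `ℓ_p`
    (∀ (p : ℝ≥0∞) [Fact (1 ≤ p)], 1 < p → p < ∞ →
      0 < numericalIndex ℂ (lp (fun _ : ℕ => ℂ) p) ∧
        IsMIdeal (numRadCompacts ℂ (lp (fun _ : ℕ => ℂ) p))) ∧
    -- the real spaces `ℓ_p`
    (∀ (p : ℝ≥0∞) [Fact (1 ≤ p)], 1 < p → p < ∞ → p ≠ 2 →
      0 < numericalIndex ℝ (lp (fun _ : ℕ => ℝ) p) ∧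
        IsMIdeal (numRadCompacts ℝ (lp (fun _ : ℕ => ℝ) p))) := by
  refine ⟨fun 𝕜 _ F _ _ _ => ⟨fun p _ hp1 hp h => isMIdeal_numRadCompacts_lp 𝕜 F hp1 hp h,
    fun h => isMIdeal_numRadCompacts_c0Sum 𝕜 F h⟩, fun p _ hp1 hp => ?_, fun p _ hp1 hp hp2 => ?_⟩
  · have h := numericalIndex_lp_complex_pos hp1 hp
    exact ⟨h, isMIdeal_numRadCompacts_lp ℂ _ hp1 hp h⟩
  · have h := numericalIndex_lp_real_pos hp1 hp hp2
    exact ⟨h, isMIdeal_numRadCompacts_lp ℝ _ hp1 hp h⟩
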